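/- Let $V$ be a finite-dimensional complex vector space with a nondegenerate symmetric bilinear form $\psi$, let $\mathrm{O}(V,\psi)$ be the group of linear automorphisms of $V$ preserving $\psi$, let $G$ be a group with a finite generating set $\{g_i\}$, and let $\pi\colon G\to \mathrm{O}(V,\psi)$ be a group homomorphism. Suppose that: (a) For each $i$ there is an element $v_i\in V$ with $\psi(v_i,v_i)=2$ such that $\pi(g_i)$ is the reflection $x\mapsto x-\psi(x,v_i)v_i$ through the hyperplane orthogonal to $v_i$; furthermore, the collection $\{v_i\}$ spans $V$. (b) The representation $\pi$ factors as $G\twoheadrightarrow H\to \mathrm{O}(V,\psi)$ through a quotient group $H$ of $G$ such that the images of all $g_i$ are conjugate to one another in $H$. Then the image of $\pi$ is either finite or Zariski-dense in $\mathrm{O}(V,\psi)$. -/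

import Mathlib

/-- The orthogonal group `O(V, ψ)`: all linear automorphisms of `V` preserving the form `ψ`. -/
def orthGroup {V : Type*} [AddCommGroup V] [Module ℂ V] (ψ : LinearMap.BilinForm ℂ V) :
    Subgroup (V ≃ₗ[ℂ] V) where
  carrier := {g | ∀ x y, ψ (g x) (g y) = ψ x y}
  one_mem' := fun _ _ => rfl
  mul_mem' := fun {a b} ha hb x y => by
    rw [LinearEquiv.mul_apply, LinearEquiv.mul_apply, ha, hb]
  inv_mem' := fun {a} ha x y => by
    have h := ha (a⁻¹ x) (a⁻¹ y)
    rw [← LinearEquiv.mul_apply, ← LinearEquiv.mul_apply, mul_inv_cancel] at h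
    exact h.symm

/-- The polynomial functions on a complex vector space `W`: the algebra of functions `W → ℂ`
generated by the linear forms (for finite-dimensional `W`, the polynomials in the coordinates
with respect to any basis). -/
def polyFunctionsOn (W : Type*) [AddCommGroup W] [Module ℂ W] : Subalgebra ℂ (W → ℂ) :=
  Algebra.adjoin ℂ (Set.range fun l : Module.Dual ℂ W => (l : W → ℂ))

/-- The Zariski topology on a complex vector space `W`, viewed as an affine space: it is generated
by the basic open sets `{x | f x ≠ 0}` with `f` a polynomial function. -/
@[reducible] def zariskiTopology (W : Type*) [AddCommGroup W] [Module ℂ W] : TopologicalSpace W :=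
  TopologicalSpace.generateFrom
    {U : Set W | ∃ f ∈ polyFunctionsOn W, U = {x | f x ≠ 0}}

/-- The Zariski topology on the orthogonal group `O(V, ψ)`, as a subset of the affine space of
endomorphisms of `V`. -/
@[reducible] def orthGroup.zariskiTopology {V : Type*} [AddCommGroup V] [Module ℂ V]
    (ψ : LinearMap.BilinForm ℂ V) : TopologicalSpace (orthGroup ψ) :=
  TopologicalSpace.induced
    (fun g : orthGroup ψ => ((g : V ≃ₗ[ℂ] V) : V →ₗ[ℂ] V)) (_root_.zariskiTopology (V →ₗ[ℂ] V))

/-!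
The proof splits according to whether products of two reflections of the group have finite order.

Put `c = ψ (x, y)` for vectors of norm `2`. The product of the two reflections has eigenvalue `μ²`
where `c = μ + μ⁻¹`, so if it has finite order then `μ` is a root of unity. If this happens for all
pairs `x = γ (v i)`, `y = v j`, then the matrix entries `ψ (γ (v i), v j)` are algebraic integers
all of whose conjugates have absolute value at most `2`. They lie in the number field generated by
the `ψ (v i, v j)`, because the reflections have matrices over that field, so they take finitely many
values (`finite_isRootOfUnitySum`). As the `v i` span and `ψ` is nondegenerate, the group is finite
(`finite_range_of_pow_eq_one`).

Otherwise some pair of reflections generates an infinite dihedral group. The coefficients of the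
reflection in `a + t z` are rational functions of `t`, so a Zariski closed set containing it for
infinitely many `t` contains it for all `t` (`orthReflection_mem_of_infinite`). Hence the closure of
the group contains all reflections of the plane of such a pair (`orthReflection_mem_of_plane`). Call
a subspace `W` full if all of its reflections lie in the closure. If a full `W` has rank at least `2`
and the reflection vector `v` is not orthogonal to `W`, then generic vectors `w` of `W` form with `v`
a pair of infinite order, since `ψ (v, w) ^ 2 / ψ (w, w)` is a nonconstant function. So generic planes
through `v` are full, and `W + ℂ v` is full (`ContainsReflections.sup_span`). A maximal full subspace
therefore contains or is orthogonal to each `v i`. Because the generators are conjugate, it is all of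
`V` (`eq_bot_or_eq_top_of_conj`). The closure then contains all reflections, hence `O(V, ψ)` by
Cartan–Dieudonné (`mem_of_isometry_of_containsReflections_top`).
-/

/-! ### Reflections -/

section Reflections

variable {V : Type*} [AddCommGroup V] [Module ℂ V] {ψ : LinearMap.BilinForm ℂ V}

/-- The reflection `y ↦ y - (2 ψ(x, y) / ψ(x, x)) x` in the hyperplane orthogonal to `x`, as an
endomorphism of `V`. It is meaningful only when `ψ x x ≠ 0`; otherwise division by zero makes it
the identity. -/
noncomputable def orthReflection (ψ : LinearMap.BilinForm ℂ V) (x : V) : Module.End ℂ V :=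
  LinearMap.id - (2 / ψ x x) • (ψ x).smulRight x

lemma orthReflection_apply (x y : V) :
    orthReflection ψ x y = y - (2 / ψ x x * ψ x y) • x := by
  simp [orthReflection, mul_smul]

lemma orthReflection_smul {c : ℂ} (hc : c ≠ 0) (x : V) :
    orthReflection ψ (c • x) = orthReflection ψ x := by
  ext y
  rw [orthReflection_apply, orthReflection_apply, smul_smul]
  congr 2
  simp only [map_smul, LinearMap.smul_apply, smul_eq_mul]
  by_cases h : ψ x x = 0
  · simp [h]
  · field_simp

lemma orthReflection_self {x : V} (hx : ψ x x ≠ 0) : orthReflection ψ x x = -x := by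
  rw [orthReflection_apply, div_mul_cancel₀ _ hx, two_smul]
  abel

lemma orthReflection_of_orthogonal {x y : V} (h : ψ x y = 0) : orthReflection ψ x y = y := by
  simp [orthReflection_apply, h]

lemma orthReflection_isometry (hψ : ψ.IsSymm) (x y z : V) :
    ψ (orthReflection ψ x y) (orthReflection ψ x z) = ψ y z := by
  simp only [orthReflection_apply, map_sub, map_smul, LinearMap.sub_apply, LinearMap.smul_apply,
    smul_eq_mul, hψ.eq y x]
  by_cases h : ψ x x = 0
  · simp [h]
  · field_simp
    ring

lemma orthReflection_mul_self (x : V) :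
    orthReflection ψ x * orthReflection ψ x = 1 := by
  ext y
  simp only [Module.End.mul_apply, orthReflection_apply, map_sub, map_smul,
    Module.End.one_apply]
  by_cases h : ψ x x = 0
  · simp [h]
  · match_scalars <;> field_simp
    ring

/-- Reflections are conjugated by isometries; the case of a conjugating reflection. -/
lemma orthReflection_orthReflection (hψ : ψ.IsSymm) (a x : V) :
    orthReflection ψ (orthReflection ψ a x) =
      orthReflection ψ a * orthReflection ψ x * orthReflection ψ a := by
  ext y
  have h1 : orthReflection ψ a (orthReflection ψ a y) = y :=
    congrArg (fun f : Module.End ℂ V => f y) (orthReflection_mul_self a)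
  rw [Module.End.mul_apply, Module.End.mul_apply, orthReflection_apply (ψ := ψ) x, map_sub,
    map_smul, h1, orthReflection_apply (orthReflection ψ a x), orthReflection_isometry hψ]
  rw [← orthReflection_isometry hψ a x (orthReflection ψ a y), h1]

lemma eq_zero_of_forall_orthogonal (hψ : ψ.IsSymm) (hnd : ψ.Nondegenerate)
    {ι : Type*} {v : ι → V}
    (hspan : Submodule.span ℂ (Set.range v) = ⊤) {x : V} (h : ∀ i, ψ (v i) x = 0) : x = 0 := by
  have hker : (⊤ : Submodule ℂ V) ≤ LinearMap.ker (ψ x) := by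
    rw [← hspan, Submodule.span_le]
    rintro _ ⟨i, rfl⟩
    rw [SetLike.mem_coe, LinearMap.mem_ker, hψ.eq, h i]
  exact hnd.1 x fun y => LinearMap.mem_ker.mp (hker Submodule.mem_top)

lemma exists_smul_norm_two {x : V} (hx : ψ x x ≠ 0) :
    ∃ c : ℂ, c ≠ 0 ∧ ψ (c • x) (c • x) = 2 := by
  obtain ⟨c, hc⟩ := IsAlgClosed.exists_pow_nat_eq (2 / ψ x x) (n := 2) (by norm_num)
  refine ⟨c, ?_, ?_⟩
  · rintro rfl
    have : 2 / ψ x x ≠ 0 := div_ne_zero two_ne_zero hx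
    exact this (by rw [← hc]; norm_num)
  · simp only [map_smul, LinearMap.smul_apply, smul_eq_mul]
    rw [← mul_assoc, ← sq, hc, div_mul_cancel₀ _ hx]

lemma orthReflection_apply_of_norm_two {x : V} (hx : ψ x x = 2) (y : V) :
    orthReflection ψ x y = y - ψ x y • x := by
  simp [orthReflection_apply, hx]

lemma exists_eq_add_inv (c : ℂ) : ∃ μ : ℂ, μ ≠ 0 ∧ c = μ + μ⁻¹ := by
  obtain ⟨s, hs⟩ := IsAlgClosed.exists_pow_nat_eq (c ^ 2 - 4) (n := 2) (by norm_num)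
  have hquad : ((c + s) / 2) ^ 2 - c * ((c + s) / 2) + 1 = 0 := by linear_combination hs / 4
  have h0 : (c + s) / 2 ≠ 0 := by
    intro h
    rw [h] at hquad
    norm_num at hquad
  refine ⟨(c + s) / 2, h0, mul_right_cancel₀ h0 ?_⟩
  rw [add_mul, inv_mul_cancel₀ h0]
  linear_combination -hquad

/-- If the product of the reflections in two vectors of norm `2` has finite order, then
`ψ x y = 2 cos(π k / n)` for some `k, n`, expressed through a root of unity. -/
lemma exists_rootOfUnity_of_pow_eq_one (hψ : ψ.IsSymm) {x y : V} (hx : ψ x x = 2) (hy : ψ y y = 2)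
    {n : ℕ} (h : (orthReflection ψ x * orthReflection ψ y) ^ n = 1) :
    ∃ μ : ℂ, μ ≠ 0 ∧ ψ x y = μ + μ⁻¹ ∧ μ ^ (2 * n) = 1 := by
  obtain ⟨μ, hμ0, hc⟩ := exists_eq_add_inv (ψ x y)
  have hμ : μ ^ 2 - ψ x y * μ + 1 = 0 := by
    rw [hc, add_mul, inv_mul_cancel₀ hμ0]
    ring
  refine ⟨μ, hμ0, hc, ?_⟩
  -- `μ x - y` is an eigenvector of the product, with eigenvalue `μ ^ 2`, unless it vanishes.
  have heig : (orthReflection ψ x * orthReflection ψ y) (μ • x - y) = μ ^ 2 • (μ • x - y) := by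
    rw [Module.End.mul_apply, orthReflection_apply_of_norm_two hy,
      orthReflection_apply_of_norm_two hx]
    simp only [map_sub, map_smul, smul_eq_mul, hx, hy, hψ.eq y x]
    match_scalars
    · linear_combination (-(ψ x y) - μ) * hμ
    · linear_combination hμ
  by_cases h0 : μ • x - y = 0
  · have hy' : y = μ • x := (sub_eq_zero.mp h0).symm
    have h2 : μ ^ 2 * 2 = 2 := by
      rw [hy'] at hy
      simp only [map_smul, LinearMap.smul_apply, smul_eq_mul, hx] at hy
      linear_combination hy
    rw [pow_mul, mul_right_cancel₀ two_ne_zero (h2.trans (one_mul 2).symm), one_pow]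
  · have hpow : ∀ k : ℕ, ((orthReflection ψ x * orthReflection ψ y) ^ k) (μ • x - y) =
        (μ ^ 2) ^ k • (μ • x - y) := by
      intro k
      induction k with
      | zero => simp
      | succ k ih => rw [pow_succ, Module.End.mul_apply, heig, map_smul, ih, smul_smul, ← pow_succ']
    have := hpow n
    rw [h, Module.End.one_apply] at this
    rw [pow_mul]
    have h3 : ((μ ^ 2) ^ n - 1) • (μ • x - y) = 0 := by rw [sub_smul, one_smul, ← this, sub_self]
    exact sub_eq_zero.mp ((smul_eq_zero.mp h3).resolve_right h0)

/-- If `ψ x y ^ 2 / (ψ x x * ψ y y)` has negative real part, the product of the two reflections has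
infinite order: for finite order the ratio is of the form `cos² θ` with `θ` real. -/
lemma pow_ne_one_of_re_neg (hψ : ψ.IsSymm) {x y : V} (hx : ψ x x ≠ 0) (hy : ψ y y ≠ 0)
    (hneg : (ψ x y ^ 2 / (ψ x x * ψ y y)).re < 0) {n : ℕ} (hn : 0 < n) :
    (orthReflection ψ x * orthReflection ψ y) ^ n ≠ 1 := by
  intro h
  obtain ⟨a, ha, hxa⟩ := exists_smul_norm_two hx
  obtain ⟨b, hb, hyb⟩ := exists_smul_norm_two hy
  rw [← orthReflection_smul ha x, ← orthReflection_smul hb y] at h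
  obtain ⟨μ, hμ0, hμ, hμn⟩ := exists_rootOfUnity_of_pow_eq_one hψ hxa hyb h
  have hnorm : ‖μ‖ = 1 := Complex.norm_eq_one_of_pow_eq_one hμn (by omega)
  have hinv : μ⁻¹ = (starRingEnd ℂ) μ := by
    rw [Complex.inv_def, Complex.normSq_eq_norm_sq, hnorm]
    simp
  have hr : ψ x y ^ 2 / (ψ x x * ψ y y) = (((2 * μ.re) ^ 2 / 4 : ℝ) : ℂ) := by
    have h1 : ψ (a • x) (b • y) = ((2 * μ.re : ℝ) : ℂ) := by
      rw [hμ, hinv, Complex.add_conj]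
    simp only [map_smul, LinearMap.smul_apply, smul_eq_mul] at h1 hxa hyb
    rw [div_eq_iff (mul_ne_zero hx hy)]
    push_cast at h1 ⊢
    have h2 : a ^ 2 * b ^ 2 ≠ 0 := mul_ne_zero (pow_ne_zero _ ha) (pow_ne_zero _ hb)
    apply mul_left_cancel₀ h2
    have e1 : a ^ 2 * ψ x x = 2 := by linear_combination hxa
    have e2 : b ^ 2 * ψ y y = 2 := by linear_combination hyb
    calc a ^ 2 * b ^ 2 * ψ x y ^ 2 = (b * (a * ψ x y)) ^ 2 := by ring
      _ = (2 * (μ.re : ℂ)) ^ 2 / 4 * ((a ^ 2 * ψ x x) * (b ^ 2 * ψ y y)) := by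
          rw [h1, e1, e2]; ring
      _ = _ := by ring
  rw [hr, Complex.ofReal_re] at hneg
  nlinarith [sq_nonneg (2 * μ.re)]

end Reflections

/-! ### Zariski closure -/

section ZariskiClosure

lemma polyFunctionsOn_comp {W W' : Type*} [AddCommGroup W] [Module ℂ W] [AddCommGroup W']
    [Module ℂ W'] (L : W →ₗ[ℂ] W') {F : W' → ℂ} (hF : F ∈ polyFunctionsOn W') :
    (fun x => F (L x)) ∈ polyFunctionsOn W := by
  unfold polyFunctionsOn at hF
  induction hF using Algebra.adjoin_induction with
  | mem F hF =>
    obtain ⟨l, rfl⟩ := hF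
    exact Algebra.subset_adjoin ⟨l.comp L, rfl⟩
  | algebraMap r => exact (polyFunctionsOn W).algebraMap_mem r
  | add F F' _ _ h h' => exact add_mem h h'
  | mul F F' _ _ h h' => exact mul_mem h h'

variable {V : Type*} [AddCommGroup V] [Module ℂ V] {ψ : LinearMap.BilinForm ℂ V}

/-- The Zariski closure in `End V` of a submonoid `Γ`: the common zeros of the polynomial functions
vanishing on `Γ`. It is again a submonoid. -/
def zariskiClosure (Γ : Submonoid (Module.End ℂ V)) : Submonoid (Module.End ℂ V) where
  carrier := {g | ∀ F ∈ polyFunctionsOn (Module.End ℂ V), (∀ γ ∈ Γ, F γ = 0) → F g = 0}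
  one_mem' := fun _ _ h => h 1 Γ.one_mem
  mul_mem' := by
    intro a b ha hb F hF h
    -- Left translation by `γ ∈ Γ` preserves the closure; then so does right translation by `b`.
    have key : ∀ γ ∈ Γ, F (γ * b) = 0 := fun γ hγ =>
      hb (fun x => F (γ * x)) (polyFunctionsOn_comp (LinearMap.mulLeft ℂ γ) hF)
        fun δ hδ => h _ (Γ.mul_mem hγ hδ)
    exact ha (fun x => F (x * b)) (polyFunctionsOn_comp (LinearMap.mulRight ℂ b) hF) key

lemma mem_zariskiClosure {Γ : Submonoid (Module.End ℂ V)} {g : Module.End ℂ V} :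
    g ∈ zariskiClosure Γ ↔
      ∀ F ∈ polyFunctionsOn (Module.End ℂ V), (∀ γ ∈ Γ, F γ = 0) → F g = 0 :=
  Iff.rfl

lemma le_zariskiClosure (Γ : Submonoid (Module.End ℂ V)) : Γ ≤ zariskiClosure Γ :=
  fun _ hg _ _ h => h _ hg

open Polynomial

lemma exists_polynomial_norm_line (ψ : LinearMap.BilinForm ℂ V) (a z : V) :
    ∃ Q : ℂ[X], ∀ t : ℂ, ψ (a + t • z) (a + t • z) = Q.eval t := by
  refine ⟨C (ψ a a) + X * C (ψ a z + ψ z a) + X ^ 2 * C (ψ z z), fun t => ?_⟩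
  simp only [map_add, map_smul, LinearMap.add_apply, LinearMap.smul_apply, smul_eq_mul, eval_add,
    eval_mul, eval_C, eval_X, eval_pow]
  ring

/-- After clearing the denominator, a polynomial function of the reflection in `a + t z` is a
polynomial in `t`. -/
lemma exists_polynomial_orthReflection_line (a z : V) {F : Module.End ℂ V → ℂ}
    (hF : F ∈ polyFunctionsOn (Module.End ℂ V)) :
    ∃ (N : ℕ) (P : ℂ[X]), ∀ t : ℂ, ψ (a + t • z) (a + t • z) ≠ 0 →
      F (orthReflection ψ (a + t • z)) * ψ (a + t • z) (a + t • z) ^ N = P.eval t := by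
  obtain ⟨Q, hQ⟩ := exists_polynomial_norm_line ψ a z
  unfold polyFunctionsOn at hF
  induction hF using Algebra.adjoin_induction with
  | mem F hF =>
    obtain ⟨l, rfl⟩ := hF
    refine ⟨1, C (l LinearMap.id) * Q - C 2 * (C (l ((ψ a).smulRight a)) +
      X * C (l ((ψ a).smulRight z) + l ((ψ z).smulRight a)) + X ^ 2 * C (l ((ψ z).smulRight z))),
      fun t ht => ?_⟩
    have hexp : (ψ (a + t • z)).smulRight (a + t • z) = (ψ a).smulRight a +
        t • ((ψ a).smulRight z + (ψ z).smulRight a) + t ^ 2 • (ψ z).smulRight z := by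
      ext y
      simp only [map_add, map_smul, LinearMap.smulRight_apply, LinearMap.add_apply,
        LinearMap.smul_apply, smul_eq_mul]
      module
    simp only [orthReflection, map_sub, map_smul, pow_one, smul_eq_mul, eval_sub, eval_mul,
      eval_C, eval_add, eval_X, eval_pow, ← hQ]
    rw [hexp]
    simp only [map_add, map_smul, smul_eq_mul] at ht ⊢
    field_simp
  | algebraMap r => exact ⟨0, C r, fun t _ => by simp⟩
  | add F F' _ _ h h' =>
    obtain ⟨N, P, h⟩ := h
    obtain ⟨N', P', h'⟩ := h'
    refine ⟨N + N', P * Q ^ N' + P' * Q ^ N, fun t ht => ?_⟩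
    rw [eval_add, eval_mul, eval_mul, eval_pow, eval_pow, ← h t ht, ← h' t ht, ← hQ, Pi.add_apply]
    ring
  | mul F F' _ _ h h' =>
    obtain ⟨N, P, h⟩ := h
    obtain ⟨N', P', h'⟩ := h'
    refine ⟨N + N', P * P', fun t ht => ?_⟩
    rw [eval_mul, ← h t ht, ← h' t ht, Pi.mul_apply]
    ring

/-- If the closure contains the reflections in infinitely many vectors of a line, it contains the
reflections in all nonisotropic vectors of the line. -/
lemma orthReflection_mem_of_infinite {Γ : Submonoid (Module.End ℂ V)} {a z : V}
    (hinf : {t : ℂ | ψ (a + t • z) (a + t • z) ≠ 0 ∧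
      orthReflection ψ (a + t • z) ∈ zariskiClosure Γ}.Infinite)
    {t : ℂ} (ht : ψ (a + t • z) (a + t • z) ≠ 0) :
    orthReflection ψ (a + t • z) ∈ zariskiClosure Γ := by
  intro F hF hΓ
  obtain ⟨N, P, hP⟩ := exists_polynomial_orthReflection_line (ψ := ψ) a z hF
  have hP0 : P = 0 := by
    refine P.eq_zero_of_infinite_isRoot (hinf.mono fun s hs => ?_)
    rw [Set.mem_ofPred_eq, IsRoot.def, ← hP s hs.1, hs.2 F hF hΓ, zero_mul]
  have := hP t ht
  rw [hP0, eval_zero] at this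
  exact (mul_eq_zero.mp this).resolve_right (pow_ne_zero _ ht)

/-- If the product of the reflections in `r` and `s` has infinite order, the dihedral group they
generate is Zariski dense in the group generated by the reflections of the plane of `r` and `s`. -/
lemma orthReflection_mem_of_plane (hψ : ψ.IsSymm) {Γ : Submonoid (Module.End ℂ V)} {r s : V}
    (hr : ψ r r ≠ 0) (hrM : orthReflection ψ r ∈ zariskiClosure Γ)
    (hsM : orthReflection ψ s ∈ zariskiClosure Γ)
    (hinf : ∀ n : ℕ, 0 < n → (orthReflection ψ r * orthReflection ψ s) ^ n ≠ 1)
    (a b : ℂ) (h : ψ (a • r + b • s) (a • r + b • s) ≠ 0) :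
    orthReflection ψ (a • r + b • s) ∈ zariskiClosure Γ := by
  set M := zariskiClosure Γ
  set T := orthReflection ψ r * orthReflection ψ s with hT
  have hrr := orthReflection_mul_self (ψ := ψ) r
  have hss := orthReflection_mul_self (ψ := ψ) s
  have hTM : T ∈ M := M.mul_mem hrM hsM
  have hunit : IsUnit T := by
    have hr' : IsUnit (orthReflection ψ r) := ⟨⟨_, _, hrr, hrr⟩, rfl⟩
    have hs' : IsUnit (orthReflection ψ s) := ⟨⟨_, _, hss, hss⟩, rfl⟩
    exact hr'.mul hs'
  -- The reflections in the iterates `T ^ n r` are pairwise distinct.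
  have hiter : ∀ n : ℕ, orthReflection ψ ((T ^ n) r) = T ^ (2 * n) * orthReflection ψ r := by
    intro n
    induction n with
    | zero => simp
    | succ n ih =>
      rw [pow_succ', Module.End.mul_apply]
      nth_rewrite 1 [hT]
      rw [Module.End.mul_apply, orthReflection_orthReflection hψ, orthReflection_orthReflection hψ,
        ih, show 2 * (n + 1) = 1 + 2 * n + 1 by ring, pow_succ, pow_add, pow_one, hT]
      simp only [mul_assoc]
  have hinj : Function.Injective fun n : ℕ => T ^ (2 * n) * orthReflection ψ r := by
    have aux : ∀ n m : ℕ, n < m →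
        T ^ (2 * n) * orthReflection ψ r ≠ T ^ (2 * m) * orthReflection ψ r := by
      intro n m hnm heq
      have h1 : T ^ (2 * n) = T ^ (2 * m) := by
        have := congrArg (· * orthReflection ψ r) heq
        simpa only [mul_assoc, hrr, mul_one] using this
      rw [show 2 * m = 2 * n + 2 * (m - n) by omega, pow_add] at h1
      refine hinf (2 * (m - n)) (by omega) ?_
      exact (hunit.pow (2 * n)).mul_left_cancel (by rw [← h1, mul_one])
    intro n m hnm
    rcases lt_trichotomy n m with hlt | heq | hgt
    · exact (aux n m hlt hnm).elim
    · exact heq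
    · exact (aux m n hgt hnm.symm).elim
  have hplane : ∀ n : ℕ, ∃ α β : ℂ, (T ^ n) r = α • r + β • s := by
    intro n
    induction n with
    | zero => exact ⟨1, 0, by simp⟩
    | succ n ih =>
      obtain ⟨α, β, ih⟩ := ih
      rw [pow_succ', Module.End.mul_apply, ih, hT, Module.End.mul_apply, orthReflection_apply s,
        orthReflection_apply r]
      have hcomb : ∀ k l : ℂ, ∃ α' β' : ℂ, α • r + β • s - k • s - l • r = α' • r + β' • s :=
        fun k l => ⟨α - l, β - k, by module⟩
      exact hcomb _ _
  have hnorm : ∀ n : ℕ, ψ ((T ^ n) r) ((T ^ n) r) = ψ r r := by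
    intro n
    induction n with
    | zero => simp
    | succ n ih =>
      rw [pow_succ', Module.End.mul_apply, hT, Module.End.mul_apply, orthReflection_isometry hψ,
        orthReflection_isometry hψ, ← hT, ih]
  have hline : {t : ℂ | ψ (s + t • r) (s + t • r) ≠ 0 ∧
      orthReflection ψ (s + t • r) ∈ M}.Infinite := by
    refine Set.Infinite.of_image (fun t => orthReflection ψ (s + t • r)) ?_
    refine ((Set.infinite_range_of_injective hinj).sdiff
      (Set.finite_singleton (orthReflection ψ r))).mono ?_
    rintro _ ⟨⟨n, rfl⟩, hne⟩
    obtain ⟨α, β, hαβ⟩ := hplane n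
    have hβ : β ≠ 0 := by
      rintro rfl
      rw [zero_smul, add_zero] at hαβ
      have hα : α ≠ 0 := by
        rintro rfl
        have := hnorm n
        rw [hαβ] at this
        simp at this
        exact hr this.symm
      refine hne ?_
      simp only [Set.mem_singleton_iff]
      rw [← hiter, hαβ, orthReflection_smul hα]
    have hx : (T ^ n) r = β • (s + (β⁻¹ * α) • r) := by
      rw [hαβ, smul_add, smul_smul, mul_inv_cancel_left₀ hβ, add_comm]
    have he : orthReflection ψ (s + (β⁻¹ * α) • r) = T ^ (2 * n) * orthReflection ψ r := by
      rw [← hiter, hx, orthReflection_smul hβ]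
    refine ⟨β⁻¹ * α, ⟨?_, ?_⟩, he⟩
    · intro h0
      have := hnorm n
      rw [hx] at this
      simp only [map_smul, LinearMap.smul_apply, h0, smul_zero] at this
      exact hr this.symm
    · rw [he]
      exact M.mul_mem (M.pow_mem hTM _) hrM
  by_cases hb : b = 0
  · subst hb
    rw [zero_smul, add_zero] at h ⊢
    have ha : a ≠ 0 := by
      rintro rfl
      simp at h
    rwa [orthReflection_smul ha]
  · have hx : a • r + b • s = b • (s + (b⁻¹ * a) • r) := by
      rw [smul_add, smul_smul, mul_inv_cancel_left₀ hb, add_comm]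
    rw [hx, orthReflection_smul hb]
    refine orthReflection_mem_of_infinite hline fun h0 => h ?_
    rw [hx]
    simp only [map_smul, LinearMap.smul_apply, h0, smul_zero]

end ZariskiClosure

/-! ### Subspaces all of whose reflections lie in the closure -/

section GoodSubspaces

variable {V : Type*} [AddCommGroup V] [Module ℂ V] {ψ : LinearMap.BilinForm ℂ V}

/-- All reflections in nonisotropic vectors of `W` belong to `M`. -/
def ContainsReflections (ψ : LinearMap.BilinForm ℂ V) (M : Submonoid (Module.End ℂ V))
    (W : Submodule ℂ V) : Prop :=
  ∀ x ∈ W, ψ x x ≠ 0 → orthReflection ψ x ∈ M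

/-- The condition on `z` makes the reflections in `v` and in a generic vector of `W` generate an
infinite group, so that generic planes through `v` and a vector of `W` can be filled. -/
lemma ContainsReflections.sup_span (hψ : ψ.IsSymm) {Γ : Submonoid (Module.End ℂ V)}
    {W : Submodule ℂ V} (hW : ContainsReflections ψ (zariskiClosure Γ) W) {v : V}
    (hv : ψ v v ≠ 0) (hvM : orthReflection ψ v ∈ zariskiClosure Γ) {z : V} (hzW : z ∈ W)
    (hz : ψ z z ≠ 0) (hneg : (ψ v z ^ 2 / (ψ v v * ψ z z)).re < 0) :
    ContainsReflections ψ (zariskiClosure Γ) (W ⊔ Submodule.span ℂ {v}) := by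
  intro x hx hxx
  obtain ⟨w, hw, u, hu, rfl⟩ := Submodule.mem_sup.mp hx
  obtain ⟨a, rfl⟩ := Submodule.mem_span_singleton.mp hu
  set x := w + a • v with hxdef
  -- The vector `x` is moved towards `z` along a line; near `z` all conditions are open.
  have hcont : ∀ y y' u u' : V, Continuous fun ε : ℂ => ψ (y + ε • y') (u + ε • u') := by
    intro y y' u u'
    simp only [map_add, map_smul, LinearMap.add_apply, LinearMap.smul_apply, smul_eq_mul]
    fun_prop
  have h1 : ∀ᶠ ε : ℂ in nhds 0, ψ (z + ε • x) (z + ε • x) ≠ 0 :=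
    (hcont z x z x).continuousAt.eventually_ne (by simpa using hz)
  have h2 : ∀ᶠ ε : ℂ in nhds 0, ψ (z + ε • w) (z + ε • w) ≠ 0 :=
    (hcont z w z w).continuousAt.eventually_ne (by simpa using hz)
  have h3 : ∀ᶠ ε : ℂ in nhds 0,
      (ψ v (z + ε • w) ^ 2 / (ψ v v * ψ (z + ε • w) (z + ε • w))).re < 0 := by
    have hc : ContinuousAt (fun ε : ℂ =>
        (ψ v (z + ε • w) ^ 2 / (ψ v v * ψ (z + ε • w) (z + ε • w))).re) 0 := by
      refine Complex.continuous_re.continuousAt.comp (ContinuousAt.div ?_ ?_ ?_)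
      · have := hcont v 0 z w
        simp only [smul_zero, add_zero] at this
        exact (this.pow 2).continuousAt
      · exact (continuous_const.mul (hcont z w z w)).continuousAt
      · simpa using ⟨hv, hz⟩
    exact hc.eventually_lt continuousAt_const (by simpa using hneg)
  have hinf := ((infinite_of_mem_nhds (0 : ℂ) ((h1.and h2).and h3)).sdiff
    (Set.finite_singleton (0 : ℂ))).image (f := fun ε : ℂ => ε⁻¹) inv_injective.injOn
  have hmem : {t : ℂ | ψ (x + t • z) (x + t • z) ≠ 0 ∧
      orthReflection ψ (x + t • z) ∈ zariskiClosure Γ}.Infinite := by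
    refine hinf.mono ?_
    rintro _ ⟨ε, ⟨⟨⟨e1, e2⟩, e3⟩, e0⟩, rfl⟩
    have hε : ε ≠ 0 := e0
    have hεi : ε⁻¹ ≠ 0 := inv_ne_zero hε
    have hxe : x + ε⁻¹ • z = ε⁻¹ • (z + ε • x) := by
      rw [smul_add, smul_smul, inv_mul_cancel₀ hε, one_smul, add_comm]
    have hpl : z + ε • x = (ε * a) • v + (1 : ℂ) • (z + ε • w) := by
      rw [hxdef]
      module
    change ψ (x + ε⁻¹ • z) (x + ε⁻¹ • z) ≠ 0 ∧ orthReflection ψ (x + ε⁻¹ • z) ∈ _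
    rw [hxe, orthReflection_smul hεi]
    refine ⟨?_, ?_⟩
    · rw [map_smul, map_smul, LinearMap.smul_apply]
      exact smul_ne_zero hεi (smul_ne_zero hεi e1)
    · rw [hpl] at e1 ⊢
      exact orthReflection_mem_of_plane hψ hv hvM
        (hW _ (W.add_mem hzW (W.smul_mem _ hw)) e2)
        (fun n hn => pow_ne_one_of_re_neg hψ hv e2 e3 hn) _ _ e1
  have := orthReflection_mem_of_infinite hmem (t := 0) (by simpa using hxx)
  simpa using this

lemma exists_re_neg_of_orthogonal (hψ : ψ.IsSymm) {W : Submodule ℂ V} {v y z : V}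
    (hv : ψ v v = 2) (hy : y ∈ W) (hz : z ∈ W) (hvy : ψ v y = 0) (hvz : ψ v z ≠ 0)
    (h : ψ y y ≠ 0 ∨ ψ z y ≠ 0) :
    ∃ u ∈ W, ψ u u ≠ 0 ∧ (ψ v u ^ 2 / (ψ v v * ψ u u)).re < 0 := by
  -- On the line `z + t y` the value `ψ v` is constant, and the norm takes every complex value.
  obtain ⟨t, ht⟩ : ∃ t : ℂ, ψ z z + 2 * t * ψ z y + t ^ 2 * ψ y y = -ψ v z ^ 2 := by
    by_cases hyy : ψ y y = 0
    · have hzy := h.resolve_left (not_not.mpr hyy)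
      refine ⟨(-ψ v z ^ 2 - ψ z z) / (2 * ψ z y), ?_⟩
      rw [hyy]
      field_simp
      ring
    · obtain ⟨d, hd⟩ := IsAlgClosed.exists_pow_nat_eq
        (ψ z y ^ 2 - ψ y y * (ψ z z + ψ v z ^ 2)) (n := 2) (by norm_num)
      refine ⟨(d - ψ z y) / ψ y y, ?_⟩
      field_simp
      linear_combination hd
  have hu : ψ (z + t • y) (z + t • y) = -ψ v z ^ 2 := by
    rw [← ht]
    simp only [map_add, map_smul, LinearMap.add_apply, LinearMap.smul_apply, smul_eq_mul,
      hψ.eq y z]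
    ring
  have hvu : ψ v (z + t • y) = ψ v z := by
    rw [map_add, map_smul, hvy, smul_zero, add_zero]
  refine ⟨z + t • y, W.add_mem hz (W.smul_mem _ hy), ?_, ?_⟩
  · rw [hu]
    exact neg_ne_zero.mpr (pow_ne_zero _ hvz)
  · rw [hu, hvu, hv, show ψ v z ^ 2 / (2 * -ψ v z ^ 2) = -(1 / 2) by field_simp]
    norm_num

lemma exists_re_neg_of_gram (hψ : ψ.IsSymm) {W : Submodule ℂ V} {v a b z : V}
    (hv : ψ v v = 2) (ha : a ∈ W) (hb : b ∈ W) (hab : ψ a a * ψ b b ≠ ψ a b ^ 2)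
    (hz : z ∈ W) (hvz : ψ v z ≠ 0) :
    ∃ u ∈ W, ψ u u ≠ 0 ∧ (ψ v u ^ 2 / (ψ v v * ψ u u)).re < 0 := by
  -- Some vector `y` of `W` orthogonal to `v` is not in the radical of `W`.
  obtain ⟨y, hy, w, hw, hvy, hwy⟩ : ∃ y ∈ W, ∃ w ∈ W, ψ v y = 0 ∧ ψ w y ≠ 0 := by
    by_contra! hcon
    by_cases h0 : ψ v a = 0 ∧ ψ v b = 0
    · have h1 := hcon a ha a ha h0.1
      have h2 := hcon b hb a ha h0.2
      exact hab (by rw [h1, h2]; ring)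
    · have hy : ψ v b • a - ψ v a • b ∈ W := W.sub_mem (W.smul_mem _ ha) (W.smul_mem _ hb)
      have hvy : ψ v (ψ v b • a - ψ v a • b) = 0 := by
        simp only [map_sub, map_smul, smul_eq_mul]
        ring
      have h1 := hcon _ hy a ha hvy
      have h2 := hcon _ hy b hb hvy
      simp only [map_sub, map_smul, smul_eq_mul, hψ.eq b a] at h1 h2
      refine h0 ⟨?_, ?_⟩
      · refine (mul_eq_zero.mp ?_).resolve_right (sub_ne_zero.mpr hab)
        linear_combination ψ a b * h1 - ψ a a * h2
      · refine (mul_eq_zero.mp ?_).resolve_right (sub_ne_zero.mpr hab)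
        linear_combination ψ b b * h1 - ψ a b * h2
  by_cases hyy : ψ y y ≠ 0 ∨ ψ z y ≠ 0
  · exact exists_re_neg_of_orthogonal hψ hv hy hz hvy hvz hyy
  · push Not at hyy
    by_cases hp : ψ v (z + w) = 0
    · refine exists_re_neg_of_orthogonal (z := z - w) hψ hv hy (W.sub_mem hz hw) hvy ?_ (Or.inr ?_)
      · rw [map_add] at hp
        rw [map_sub]
        intro hm
        exact hvz (by linear_combination (hp + hm) / 2)
      · rw [map_sub, LinearMap.sub_apply, hyy.2, zero_sub]
        exact neg_ne_zero.mpr hwy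
    · refine exists_re_neg_of_orthogonal (z := z + w) hψ hv hy (W.add_mem hz hw) hvy hp (Or.inr ?_)
      rw [map_add, LinearMap.add_apply, hyy.2, zero_add]
      exact hwy

/-- The starting point of the extension process: a subspace carrying two vectors with nonzero Gram
determinant. If the plane of `r` and `s` is degenerate, one of the `v i` not orthogonal to its
radical has to be added. -/
lemma exists_containsReflections_gram (hψ : ψ.IsSymm) (hnd : ψ.Nondegenerate)
    {Γ : Submonoid (Module.End ℂ V)} {ι : Type*} {v : ι → V} (hv : ∀ i, ψ (v i) (v i) = 2)
    (hspan : Submodule.span ℂ (Set.range v) = ⊤)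
    (hvM : ∀ i, orthReflection ψ (v i) ∈ zariskiClosure Γ) {r s : V} (hr : ψ r r = 2)
    (hs : ψ s s = 2) (hrM : orthReflection ψ r ∈ zariskiClosure Γ)
    (hsM : orthReflection ψ s ∈ zariskiClosure Γ)
    (hinf : ∀ n : ℕ, 0 < n → (orthReflection ψ r * orthReflection ψ s) ^ n ≠ 1) :
    ∃ W : Submodule ℂ V, ContainsReflections ψ (zariskiClosure Γ) W ∧
      ∃ a ∈ W, ∃ b ∈ W, ψ a a * ψ b b ≠ ψ a b ^ 2 := by
  have hP : ContainsReflections ψ (zariskiClosure Γ) (Submodule.span ℂ {r, s}) := by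
    intro x hx hxx
    obtain ⟨a, b, rfl⟩ := Submodule.mem_span_pair.mp hx
    exact orthReflection_mem_of_plane hψ (by rw [hr]; norm_num) hrM hsM hinf a b hxx
  have hrP : r ∈ Submodule.span ℂ {r, s} := Submodule.subset_span (by simp)
  have hsP : s ∈ Submodule.span ℂ {r, s} := Submodule.subset_span (by simp)
  by_cases hc : ψ r r * ψ s s = ψ r s ^ 2
  · rw [hr, hs] at hc
    set y := r - (ψ r s / 2) • s with hy
    have hyP : y ∈ Submodule.span ℂ {r, s} :=
      Submodule.sub_mem _ hrP (Submodule.smul_mem _ _ hsP)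
    have hry : ψ r y = 0 := by
      rw [hy, map_sub, map_smul, smul_eq_mul, hr]
      linear_combination hc / 2
    have hsy : ψ s y = 0 := by
      rw [hy, map_sub, map_smul, smul_eq_mul, hs, hψ.eq s r]
      ring
    have hyy : ψ y y = 0 := by
      nth_rewrite 2 [hy]
      rw [map_sub, map_smul, hψ.eq y r, hψ.eq y s, hry, hsy, smul_zero, sub_zero]
    have hy0 : y ≠ 0 := by
      intro h0
      have hc0 : ψ r s / 2 ≠ 0 := by
        intro h0
        rw [show ψ r s = 0 by linear_combination 2 * h0] at hc
        norm_num at hc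
      refine hinf 1 one_pos ?_
      rw [pow_one, sub_eq_zero.mp h0, orthReflection_smul hc0, orthReflection_mul_self]
    obtain ⟨i, hi⟩ : ∃ i, ψ (v i) y ≠ 0 := by
      by_contra! hcon
      exact hy0 (eq_zero_of_forall_orthogonal hψ hnd hspan hcon)
    obtain ⟨d, hd⟩ := IsAlgClosed.exists_pow_nat_eq (-2 : ℂ) (n := 2) (by norm_num)
    set t := (d - ψ (v i) r) / ψ (v i) y with ht
    have hzz : ψ (r + t • y) (r + t • y) = 2 := by
      simp only [map_add, map_smul, LinearMap.add_apply, LinearMap.smul_apply, smul_eq_mul,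
        hψ.eq y r, hr, hry, hyy]
      ring
    have hvz : ψ (v i) (r + t • y) = d := by
      rw [map_add, map_smul, smul_eq_mul, ht, div_mul_cancel₀ _ hi]
      ring
    refine ⟨_, hP.sup_span (v := v i) hψ (by rw [hv]; norm_num) (hvM i) (z := r + t • y)
      (Submodule.add_mem _ hrP (Submodule.smul_mem _ _ hyP)) (by rw [hzz]; norm_num) ?_,
      v i, ?_, y, Submodule.mem_sup_left hyP, ?_⟩
    · rw [hvz, hzz, hv, hd]
      norm_num
    · exact Submodule.mem_sup_right (Submodule.mem_span_singleton_self _)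
    · rw [hyy, mul_zero]
      exact (pow_ne_zero 2 hi).symm
  · exact ⟨_, hP, r, hrP, s, hsP, hc⟩

/-- A maximal subspace whose reflections lie in the closure contains every `v i` that is not
orthogonal to it; irreducibility then forces it to be everything. -/
lemma containsReflections_top (hψ : ψ.IsSymm) (hnd : ψ.Nondegenerate) [FiniteDimensional ℂ V]
    {Γ : Submonoid (Module.End ℂ V)} {ι : Type*} {v : ι → V} (hv : ∀ i, ψ (v i) (v i) = 2)
    (hspan : Submodule.span ℂ (Set.range v) = ⊤)
    (hvM : ∀ i, orthReflection ψ (v i) ∈ zariskiClosure Γ)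
    (hirr : ∀ W : Submodule ℂ V, (∀ i, v i ∈ W ∨ ∀ w ∈ W, ψ (v i) w = 0) → W = ⊥ ∨ W = ⊤)
    {r s : V} (hr : ψ r r = 2)
    (hs : ψ s s = 2) (hrM : orthReflection ψ r ∈ zariskiClosure Γ)
    (hsM : orthReflection ψ s ∈ zariskiClosure Γ)
    (hinf : ∀ n : ℕ, 0 < n → (orthReflection ψ r * orthReflection ψ s) ^ n ≠ 1) :
    ContainsReflections ψ (zariskiClosure Γ) ⊤ := by
  obtain ⟨W, ⟨hW, a, ha, b, hb, hab⟩, hmax⟩ := exists_maximal_of_wellFoundedGT _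
    (exists_containsReflections_gram hψ hnd hv hspan hvM hr hs hrM hsM hinf)
  have hWirr : ∀ i, v i ∈ W ∨ ∀ w ∈ W, ψ (v i) w = 0 := by
    intro i
    by_contra! hcon
    obtain ⟨hvW, z, hz, hvz⟩ := hcon
    obtain ⟨u, hu, huu, hneg⟩ := exists_re_neg_of_gram hψ (hv i) ha hb hab hz hvz
    have hle := hmax ⟨hW.sup_span hψ (by rw [hv]; norm_num) (hvM i) hu huu hneg,
      a, Submodule.mem_sup_left ha, b, Submodule.mem_sup_left hb, hab⟩ le_sup_left
    exact hvW (hle (Submodule.mem_sup_right (Submodule.mem_span_singleton_self _)))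
  rcases hirr W hWirr with rfl | rfl
  · rw [Submodule.mem_bot] at ha
    simp [ha] at hab
  · exact hW

end GoodSubspaces

/-! ### Generation of the orthogonal group by reflections, and density -/

section Density

variable {V : Type*} [AddCommGroup V] [Module ℂ V] {ψ : LinearMap.BilinForm ℂ V}

/-- Cartan–Dieudonné over `ℂ`, without a bound on the number of reflections. -/
lemma mem_of_isometry_of_containsReflections_top [FiniteDimensional ℂ V] (hψ : ψ.IsSymm)
    (hnd : ψ.Nondegenerate) {M : Submonoid (Module.End ℂ V)} (hM : ContainsReflections ψ M ⊤)
    {g : Module.End ℂ V} (hg : ∀ x y, ψ (g x) (g y) = ψ x y) : g ∈ M := by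
  obtain ⟨e, he⟩ := LinearMap.BilinForm.exists_orthogonal_basis (B := ψ) ⟨hψ.eq⟩
  have hne : ∀ i, ψ (e i) (e i) ≠ 0 := he.not_isOrtho_basis_self_of_separatingLeft hnd.1
  -- The basis vectors are fixed one at a time.
  suffices H : ∀ (S : Finset (Fin (Module.finrank ℂ V))) (g : Module.End ℂ V),
      (∀ x y, ψ (g x) (g y) = ψ x y) → (∀ i, i ∉ S → g (e i) = e i) → g ∈ M from
    H Finset.univ g hg fun i hi => (hi (Finset.mem_univ i)).elim
  intro S
  induction S using Finset.induction with
  | empty =>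
    intro g _ hfix
    have : g = 1 := e.ext fun i => hfix i (by simp)
    exact this ▸ M.one_mem
  | insert k S hk ih =>
    intro g hg hfix
    have horth : ∀ i, i ∉ insert k S → ψ (e k) (e i) = 0 ∧ ψ (g (e k)) (e i) = 0 := by
      intro i hi
      have hki : ψ (e k) (e i) = 0 := he fun h => hi (h ▸ Finset.mem_insert_self _ _)
      refine ⟨hki, ?_⟩
      conv_lhs => rw [← hfix i hi]
      rw [hg, hki]
    have hgk := hg (e k) (e k)
    have hsymm := hψ.eq (g (e k)) (e k)
    by_cases hm : ψ (g (e k) - e k) (g (e k) - e k) = 0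
    · -- The vectors `g (e k) - e k` and `g (e k) + e k` cannot both be isotropic.
      have hp : ψ (g (e k) + e k) (g (e k) + e k) = 4 * ψ (e k) (e k) := by
        simp only [map_sub, LinearMap.sub_apply, map_add, LinearMap.add_apply] at hm ⊢
        linear_combination -hm + 2 * hgk
      have hp0 : ψ (g (e k) + e k) (g (e k) + e k) ≠ 0 := by
        rw [hp]
        exact mul_ne_zero (by norm_num) (hne k)
      set u := g (e k) + e k with hu
      have huk : orthReflection ψ u (g (e k)) = -e k := by
        rw [orthReflection_apply]
        have h1 : 2 / ψ u u * ψ u (g (e k)) = 1 := by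
          rw [div_mul_eq_mul_div, div_eq_one_iff_eq hp0]
          simp only [hu, map_sub, LinearMap.sub_apply, map_add, LinearMap.add_apply] at hm ⊢
          linear_combination hgk - hsymm
        rw [h1, one_smul, hu]
        abel
      have hprod : orthReflection ψ (e k) * (orthReflection ψ u * g) ∈ M := by
        refine ih _ (fun x y => ?_) fun i hi => ?_
        · simp only [Module.End.mul_apply]
          rw [orthReflection_isometry hψ, orthReflection_isometry hψ, hg]
        · simp only [Module.End.mul_apply]
          by_cases hik : i = k
          · rw [hik, huk, map_neg, orthReflection_self (hne k), neg_neg]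
          · have hi' : i ∉ insert k S := by simp [hik, hi]
            rw [hfix i hi', orthReflection_of_orthogonal (x := u),
              orthReflection_of_orthogonal (horth i hi').1]
            rw [hu, map_add, LinearMap.add_apply, (horth i hi').1, (horth i hi').2, add_zero]
      have := M.mul_mem (hM u trivial hp0) (M.mul_mem (hM (e k) trivial (hne k)) hprod)
      rwa [← mul_assoc (orthReflection ψ (e k)), orthReflection_mul_self, one_mul, ← mul_assoc,
        orthReflection_mul_self, one_mul] at this
    · set u := g (e k) - e k with hu
      have huk : orthReflection ψ u (g (e k)) = e k := by
        rw [orthReflection_apply]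
        have h1 : 2 / ψ u u * ψ u (g (e k)) = 1 := by
          rw [div_mul_eq_mul_div, div_eq_one_iff_eq hm]
          simp only [hu, map_sub, LinearMap.sub_apply]
          linear_combination hgk + hsymm
        rw [h1, one_smul, hu]
        abel
      have hprod : orthReflection ψ u * g ∈ M := by
        refine ih _ (fun x y => ?_) fun i hi => ?_
        · simp only [Module.End.mul_apply]
          rw [orthReflection_isometry hψ, hg]
        · simp only [Module.End.mul_apply]
          by_cases hik : i = k
          · rw [hik, huk]
          · have hi' : i ∉ insert k S := by simp [hik, hi]
            rw [hfix i hi', orthReflection_of_orthogonal (x := u)]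
            rw [hu, map_sub, LinearMap.sub_apply, (horth i hi').1, (horth i hi').2, sub_zero]
      have := M.mul_mem (hM u trivial hm) hprod
      rwa [← mul_assoc, orthReflection_mul_self, one_mul] at this

/-- The sets `{F ≠ 0}` form a basis, not only a subbasis, of the Zariski topology. -/
lemma exists_polyFunctionsOn_of_isOpen {W : Type*} [AddCommGroup W] [Module ℂ W] {U : Set W}
    (hU : @IsOpen W (zariskiTopology W) U) {x : W} (hx : x ∈ U) :
    ∃ F ∈ polyFunctionsOn W, F x ≠ 0 ∧ ∀ y, F y ≠ 0 → y ∈ U := by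
  change TopologicalSpace.GenerateOpen _ U at hU
  induction hU with
  | basic s hs =>
    obtain ⟨F, hF, rfl⟩ := hs
    exact ⟨F, hF, hx, fun y hy => hy⟩
  | univ => exact ⟨1, one_mem _, one_ne_zero, fun y _ => trivial⟩
  | inter s t _ _ ihs iht =>
    obtain ⟨F, hF, hFx, hFs⟩ := ihs hx.1
    obtain ⟨F', hF', hFx', hFt⟩ := iht hx.2
    refine ⟨F * F', mul_mem hF hF', mul_ne_zero hFx hFx', fun y hy => ?_⟩
    exact ⟨hFs y (left_ne_zero_of_mul hy), hFt y (right_ne_zero_of_mul hy)⟩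
  | sUnion S _ ih =>
    obtain ⟨s, hs, hxs⟩ := hx
    obtain ⟨F, hF, hFx, hFs⟩ := ih s hs hxs
    exact ⟨F, hF, hFx, fun y hy => ⟨s, hs, hFs y hy⟩⟩

/-- The inclusion of the orthogonal group into the endomorphisms of `V`. -/
def orthGroupToEnd (ψ : LinearMap.BilinForm ℂ V) : orthGroup ψ →* Module.End ℂ V :=
  LinearEquiv.automorphismGroup.toLinearMapMonoidHom.comp (orthGroup ψ).subtype

lemma orthGroupToEnd_apply (g : orthGroup ψ) (x : V) :
    orthGroupToEnd ψ g x = (g : V ≃ₗ[ℂ] V) x :=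
  rfl

lemma dense_of_mem_zariskiClosure {G : Type*} [Group G] (π : G →* orthGroup ψ)
    (h : ∀ g, orthGroupToEnd ψ g ∈ zariskiClosure (MonoidHom.mrange ((orthGroupToEnd ψ).comp π))) :
    @Dense (orthGroup ψ) (orthGroup.zariskiTopology ψ) (π.range : Set (orthGroup ψ)) := by
  let := orthGroup.zariskiTopology ψ
  rw [dense_iff_inter_open]
  rintro U hU ⟨g, hg⟩
  obtain ⟨U', hU', rfl⟩ := (@isOpen_induced_iff _ _ (zariskiTopology (V →ₗ[ℂ] V)) U _).mp hU
  obtain ⟨F, hF, hFg, hFU⟩ := exists_polyFunctionsOn_of_isOpen hU' hg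
  by_contra hcon
  refine hFg (h g F hF ?_)
  rintro _ ⟨γ, rfl⟩
  by_contra hne
  exact hcon ⟨π γ, hFU _ hne, γ, rfl⟩

end Density

/-! ### Sums of a root of unity and its inverse -/

section RootsOfUnity

/-- `c` has the form `μ + μ⁻¹ = 2 cos (2π k / n)` with `μ` a root of unity. -/
def IsRootOfUnitySum (c : ℂ) : Prop :=
  ∃ (n : ℕ) (μ : ℂ), 0 < n ∧ μ ≠ 0 ∧ c = μ + μ⁻¹ ∧ μ ^ n = 1

lemma IsRootOfUnitySum.isIntegral {c : ℂ} (hc : IsRootOfUnitySum c) : IsIntegral ℤ c := by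
  obtain ⟨n, μ, hn, -, rfl, hμ⟩ := hc
  have h1 : IsIntegral ℤ μ := IsIntegral.of_pow hn (by rw [hμ]; exact isIntegral_one)
  have h2 : IsIntegral ℤ μ⁻¹ :=
    IsIntegral.of_pow hn (by rw [inv_pow, hμ, inv_one]; exact isIntegral_one)
  exact h1.add h2

lemma IsRootOfUnitySum.norm_le_two {c : ℂ} (hc : IsRootOfUnitySum c) : ‖c‖ ≤ 2 := by
  obtain ⟨n, μ, hn, -, rfl, hμ⟩ := hc
  have h1 : ‖μ‖ = 1 := Complex.norm_eq_one_of_pow_eq_one hμ hn.ne'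
  calc ‖μ + μ⁻¹‖ ≤ ‖μ‖ + ‖μ⁻¹‖ := norm_add_le _ _
    _ = 2 := by rw [norm_inv, h1]; norm_num

/-- The property is preserved by field embeddings: it amounts to `D c = 2` for some Dickson
polynomial `D`, and these have integral coefficients. -/
lemma IsRootOfUnitySum.map_embedding {K : IntermediateField ℚ ℂ} {c : K}
    (hc : IsRootOfUnitySum c) (φ : K →+* ℂ) : IsRootOfUnitySum (φ c) := by
  obtain ⟨n, μ, hn, hμ0, hcμ, hμ⟩ := hc
  have hD : (Polynomial.dickson 1 (1 : K) n).eval c = 2 := by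
    apply (algebraMap K ℂ).injective
    rw [← Polynomial.eval₂_hom, ← Polynomial.eval_map, Polynomial.map_dickson, map_one]
    change Polynomial.eval (c : ℂ) _ = _
    rw [hcμ, Polynomial.dickson_one_one_eval_add_inv _ _ (mul_inv_cancel₀ hμ0), inv_pow, hμ,
      map_ofNat]
    norm_num
  have hD' : (Polynomial.dickson 1 (1 : ℂ) n).eval (φ c) = 2 := by
    rw [← map_one φ, ← Polynomial.map_dickson, Polynomial.eval_map, Polynomial.eval₂_hom, hD,
      map_ofNat]
  obtain ⟨ν, hν0, hcν⟩ := exists_eq_add_inv (φ c)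
  refine ⟨n, ν, hn, hν0, hcν, ?_⟩
  rw [hcν, Polynomial.dickson_one_one_eval_add_inv _ _ (mul_inv_cancel₀ hν0), inv_pow] at hD'
  have hνn : ν ^ n ≠ 0 := pow_ne_zero _ hν0
  field_simp at hD'
  have : (ν ^ n - 1) ^ 2 = 0 := by linear_combination hD'
  exact sub_eq_zero.mp (pow_eq_zero_iff two_ne_zero |>.mp this)

/-- Kronecker's theorem: a number field contains finitely many such numbers, as they are integral
with all conjugates of absolute value at most `2`. -/
lemma finite_isRootOfUnitySum {T : Set ℂ} (hT : T.Finite) (h : ∀ c ∈ T, IsRootOfUnitySum c) :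
    {c : ℂ | c ∈ IntermediateField.adjoin ℚ T ∧ IsRootOfUnitySum c}.Finite := by
  have := hT.to_subtype
  set K := IntermediateField.adjoin ℚ T
  have hfd : FiniteDimensional ℚ K :=
    IntermediateField.finiteDimensional_adjoin fun c hc => (h c hc).isIntegral.tower_top
  have : NumberField K := ⟨⟩
  refine ((NumberField.Embeddings.finite_of_norm_le K ℂ 2).image (algebraMap K ℂ)).subset ?_
  rintro c ⟨hcK, hc⟩
  refine ⟨⟨c, hcK⟩, ⟨?_, fun φ => ?_⟩, rfl⟩
  · exact (isIntegral_algebraMap_iff (algebraMap K ℂ).injective).mp hc.isIntegral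
  · exact (IsRootOfUnitySum.map_embedding (c := ⟨c, hcK⟩) hc φ).norm_le_two

end RootsOfUnity

/-! ### Groups generated by reflections -/

section ReflectionGroup

variable {V : Type*} [AddCommGroup V] [Module ℂ V] {ψ : LinearMap.BilinForm ℂ V}
  {G : Type*} [Group G] {ι : Type*} {g : ι → G} {π : G →* orthGroup ψ} {v : ι → V}

/-- Since reflections are involutions, a property of vectors stable under the generators is stable
under the group. -/
lemma property_apply_of_generators (hgen : Subgroup.closure (Set.range g) = ⊤)
    (hrefl : ∀ i, orthGroupToEnd ψ (π (g i)) = orthReflection ψ (v i)) {p : V → Prop}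
    (hp : ∀ i x, p x → p (orthReflection ψ (v i) x)) (γ : G) :
    ∀ x, p x → p (orthGroupToEnd ψ (π γ) x) := by
  have hγ : γ ∈ Subgroup.closure (Set.range g) := hgen ▸ Subgroup.mem_top γ
  induction hγ using Subgroup.closure_induction'' with
  | mem _ h =>
    obtain ⟨i, rfl⟩ := h
    rw [hrefl]
    exact hp i
  | inv_mem _ h =>
    obtain ⟨i, rfl⟩ := h
    have : orthGroupToEnd ψ (π (g i)⁻¹) = orthReflection ψ (v i) := by
      have h1 : orthGroupToEnd ψ (π (g i)⁻¹) * orthReflection ψ (v i) = 1 := by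
        rw [← hrefl, ← map_mul, ← map_mul, inv_mul_cancel, map_one, map_one]
      calc _ = orthGroupToEnd ψ (π (g i)⁻¹) * (orthReflection ψ (v i) * orthReflection ψ (v i)) := by
            rw [orthReflection_mul_self, mul_one]
        _ = _ := by rw [← mul_assoc, h1, one_mul]
    rw [this]
    exact hp i
  | one => simp
  | mul a b _ _ ha hb =>
    intro x hx
    rw [map_mul, map_mul]
    exact ha _ (hb x hx)

/-- Conjugacy of the generators makes the representation irreducible, in the form needed for
subspaces containing or orthogonal to each `v i`. -/
lemma eq_bot_or_eq_top_of_conj (hψ : ψ.IsSymm) (hnd : ψ.Nondegenerate)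
    (hgen : Subgroup.closure (Set.range g) = ⊤) (hv : ∀ i, ψ (v i) (v i) = 2)
    (hrefl : ∀ i, orthGroupToEnd ψ (π (g i)) = orthReflection ψ (v i))
    (hspan : Submodule.span ℂ (Set.range v) = ⊤)
    (hconj : ∀ i j, ∃ γ : G, π (g j) * π γ = π γ * π (g i)) {W : Submodule ℂ V}
    (hW : ∀ i, v i ∈ W ∨ ∀ w ∈ W, ψ (v i) w = 0) : W = ⊥ ∨ W = ⊤ := by
  by_cases hex : ∃ i, v i ∈ W
  · right
    obtain ⟨i, hi⟩ := hex
    have hstab : ∀ γ : G, ∀ x ∈ W, orthGroupToEnd ψ (π γ) x ∈ W := by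
      refine property_apply_of_generators hgen hrefl (p := (· ∈ W)) fun j x hx => ?_
      rcases hW j with hj | hj
      · rw [orthReflection_apply]
        exact W.sub_mem hx (W.smul_mem _ hj)
      · rwa [orthReflection_of_orthogonal (hj x hx)]
    rw [eq_top_iff, ← hspan, Submodule.span_le]
    rintro _ ⟨j, rfl⟩
    -- The conjugating element carries `v i` to a `-1`-eigenvector of the reflection in `v j`.
    obtain ⟨γ, hγ⟩ := hconj i j
    have h1 := congrArg (fun f => orthGroupToEnd ψ f (v i)) hγ
    have hv2 : ∀ k, ψ (v k) (v k) ≠ 0 := fun k => by rw [hv]; norm_num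
    simp only [map_mul, Module.End.mul_apply, hrefl] at h1
    rw [orthReflection_self (hv2 i), map_neg, orthReflection_apply_of_norm_two (hv j)] at h1
    set x := orthGroupToEnd ψ (π γ) (v i) with hx
    have hxW : x ∈ W := hstab γ _ hi
    have h2 : (2 : ℂ) • x = ψ (v j) x • v j := by
      rw [two_smul, ← sub_eq_zero]
      have h3 : x - ψ (v j) x • v j + x = 0 := by rw [h1, neg_add_cancel]
      rw [← h3]
      abel
    have hx0 : x ≠ 0 := by
      intro h0
      have h3 : ψ x x = 2 := ((π γ).2 (v i) (v i)).trans (hv i)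
      rw [h0, map_zero] at h3
      norm_num at h3
    have hc : ψ (v j) x ≠ 0 := by
      intro h0
      rw [h0, zero_smul] at h2
      exact smul_ne_zero two_ne_zero hx0 h2
    exact (W.smul_mem_iff hc).mp (h2 ▸ W.smul_mem _ hxW)
  · left
    push Not at hex
    rw [Submodule.eq_bot_iff]
    exact fun x hx => eq_zero_of_forall_orthogonal hψ hnd hspan fun i =>
      (hW i).resolve_left (hex i) x hx

/-- If the products of any two reflections in the group are of finite order, the matrix entries
`ψ (γ (v i)) (v j)` take finitely many values. -/
lemma finite_range_of_pow_eq_one [Finite ι] (hψ : ψ.IsSymm) (hnd : ψ.Nondegenerate)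
    (hgen : Subgroup.closure (Set.range g) = ⊤) (hv : ∀ i, ψ (v i) (v i) = 2)
    (hrefl : ∀ i, orthGroupToEnd ψ (π (g i)) = orthReflection ψ (v i))
    (hspan : Submodule.span ℂ (Set.range v) = ⊤)
    (htors : ∀ (γ : G) (i j : ι), ∃ n : ℕ, 0 < n ∧
      (orthReflection ψ (orthGroupToEnd ψ (π γ) (v i)) * orthReflection ψ (v j)) ^ n = 1) :
    (π.range : Set (orthGroup ψ)).Finite := by
  have hiso : ∀ (γ : G) x y, ψ (orthGroupToEnd ψ (π γ) x) (orthGroupToEnd ψ (π γ) y) = ψ x y :=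
    fun γ => (π γ).2
  have hsum : ∀ (γ : G) (i j : ι),
      IsRootOfUnitySum (ψ (orthGroupToEnd ψ (π γ) (v i)) (v j)) := by
    intro γ i j
    obtain ⟨n, hn, h⟩ := htors γ i j
    obtain ⟨μ, hμ0, hμ, hμn⟩ :=
      exists_rootOfUnity_of_pow_eq_one hψ ((hiso γ _ _).trans (hv i)) (hv j) h
    exact ⟨2 * n, μ, by omega, hμ0, hμ, hμn⟩
  set T : Set ℂ := Set.range fun ij : ι × ι => ψ (v ij.1) (v ij.2) with hT
  have hTsum : ∀ c ∈ T, IsRootOfUnitySum c := by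
    rintro _ ⟨⟨i, j⟩, rfl⟩
    simpa using hsum 1 i j
  set K := IntermediateField.adjoin ℚ T with hK
  have hTK : ∀ i j, ψ (v i) (v j) ∈ K := fun i j =>
    IntermediateField.subset_adjoin ℚ T ⟨(i, j), rfl⟩
  have hmem : ∀ (γ : G) (i j : ι), ψ (orthGroupToEnd ψ (π γ) (v i)) (v j) ∈ K := by
    intro γ i
    refine property_apply_of_generators hgen hrefl (p := fun x => ∀ j, ψ x (v j) ∈ K)
      (fun k x hx j => ?_) γ (v i) (hTK i)
    rw [orthReflection_apply_of_norm_two (hv k), map_sub, map_smul, LinearMap.sub_apply,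
      LinearMap.smul_apply, smul_eq_mul, hψ.eq (v k) x]
    exact K.sub_mem (hx j) (K.mul_mem (hx k) (hTK k j))
  have hfin := finite_isRootOfUnitySum (Set.finite_range _) hTsum
  have hfin' := Set.Finite.pi (ι := ι × ι) fun _ => hfin
  -- An element of the group is determined by its matrix entries with respect to the `v i`.
  refine Set.Finite.of_finite_image (f := fun (h : orthGroup ψ) (ij : ι × ι) =>
    ψ (orthGroupToEnd ψ h (v ij.1)) (v ij.2)) (hfin'.subset ?_) ?_
  · rintro _ ⟨_, ⟨γ, rfl⟩, rfl⟩ ij -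
    exact ⟨hmem γ ij.1 ij.2, hsum γ ij.1 ij.2⟩
  · rintro a - b - hab
    have hval : ∀ i, orthGroupToEnd ψ a (v i) = orthGroupToEnd ψ b (v i) := by
      intro i
      rw [← sub_eq_zero]
      refine eq_zero_of_forall_orthogonal hψ hnd hspan fun j => ?_
      have := congrFun hab (i, j)
      rw [map_sub, hψ.eq, hψ.eq (v j), sub_eq_zero]
      exact this
    have hlin : orthGroupToEnd ψ a = orthGroupToEnd ψ b :=
      LinearMap.ext_on_range hspan hval
    exact Subtype.ext (LinearEquiv.toLinearMap_injective hlin)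

end ReflectionGroup

theorem lemma6p4
    {V : Type*} [AddCommGroup V] [Module ℂ V] [FiniteDimensional ℂ V]
    (ψ : LinearMap.BilinForm ℂ V) (hsymm : ψ.IsSymm) (hnd : ψ.Nondegenerate)
    {G : Type*} [Group G]
    {ι : Type*} [Finite ι] (g : ι → G) (hgen : Subgroup.closure (Set.range g) = ⊤)
    (π : G →* orthGroup ψ)
    (v : ι → V) (hv : ∀ i, ψ (v i) (v i) = 2)
    (hrefl : ∀ i x, (π (g i) : V ≃ₗ[ℂ] V) x = x - ψ x (v i) • v i)
    (hspan : Submodule.span ℂ (Set.range v) = ⊤)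
    {H : Type*} [Group H] (q : G →* H) (hq : Function.Surjective q)
    (π' : H →* orthGroup ψ) (hfac : π = π'.comp q)
    (hconj : ∀ i j, IsConj (q (g i)) (q (g j))) :
    (π.range : Set (orthGroup ψ)).Finite ∨
      @Dense (orthGroup ψ) (orthGroup.zariskiTopology ψ) (π.range : Set (orthGroup ψ)) := by
  have hrefl' : ∀ i, orthGroupToEnd ψ (π (g i)) = orthReflection ψ (v i) := by
    intro i
    ext x
    rw [orthGroupToEnd_apply, hrefl, orthReflection_apply_of_norm_two (hv i), hsymm.eq]
  have hconj' : ∀ i j, ∃ γ : G, π (g j) * π γ = π γ * π (g i) := by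
    intro i j
    obtain ⟨c, hc⟩ := isConj_iff.mp (hconj i j)
    obtain ⟨γ, rfl⟩ := hq c
    refine ⟨γ, ?_⟩
    simp only [hfac, MonoidHom.comp_apply]
    rw [← hc, ← map_mul π', ← map_mul π', inv_mul_cancel_right]
  have hiso : ∀ (γ : G) x y, ψ (orthGroupToEnd ψ (π γ) x) (orthGroupToEnd ψ (π γ) y) = ψ x y :=
    fun γ => (π γ).2
  by_cases htors : ∀ (γ : G) (i j : ι), ∃ n : ℕ, 0 < n ∧
      (orthReflection ψ (orthGroupToEnd ψ (π γ) (v i)) * orthReflection ψ (v j)) ^ n = 1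
  · exact Or.inl (finite_range_of_pow_eq_one hsymm hnd hgen hv hrefl' hspan htors)
  · right
    push Not at htors
    obtain ⟨γ, i, j, hinf⟩ := htors
    set Γ := MonoidHom.mrange ((orthGroupToEnd ψ).comp π) with hΓ
    have hvΓ : ∀ i, orthReflection ψ (v i) ∈ zariskiClosure Γ := fun i =>
      le_zariskiClosure Γ ⟨g i, hrefl' i⟩
    have hγΓ : orthReflection ψ (orthGroupToEnd ψ (π γ) (v i)) ∈ zariskiClosure Γ := by
      -- The reflection in `γ (v i)` is the conjugate by `γ` of the reflection in `v i`.
      refine le_zariskiClosure Γ ⟨γ * g i * γ⁻¹, ?_⟩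
      have h1 : orthGroupToEnd ψ (π γ) * orthGroupToEnd ψ (π γ⁻¹) = 1 := by
        rw [← map_mul, ← map_mul, mul_inv_cancel, map_one, map_one]
      rw [MonoidHom.comp_apply, map_mul, map_mul, map_mul, map_mul, hrefl']
      ext x
      have h2 : orthGroupToEnd ψ (π γ) (orthGroupToEnd ψ (π γ⁻¹) x) = x :=
        congrArg (fun f : Module.End ℂ V => f x) h1
      rw [Module.End.mul_apply, Module.End.mul_apply, orthReflection_apply_of_norm_two (hv i),
        orthReflection_apply_of_norm_two ((hiso γ _ _).trans (hv i)), map_sub, map_smul, h2]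
      rw [← hiso γ (v i), h2]
    have htop := containsReflections_top hsymm hnd hv hspan hvΓ
      (fun W hW => eq_bot_or_eq_top_of_conj hsymm hnd hgen hv hrefl' hspan hconj' hW)
      ((hiso γ _ _).trans (hv i)) (hv j) hγΓ (hvΓ j) hinf
    exact dense_of_mem_zariskiClosure π fun h =>
      mem_of_isometry_of_containsReflections_top hsymm hnd htop h.2
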